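/- **Setting (the BB84-INFO-$z$ protocol under a collective attack).** Let $n,n_z,n_x,r,m\ge 0$ be integers and $N=n+n_z+n_x$. For a bit string $s\in\mathbf F_2^t$, $|s|$ denotes the number of its $1$-bits, and $d_H(s,s')=|s+s'|$. Let $P_C$ be an $r\times n$ matrix with rows $v_1,\dots,v_r\in\mathbf F_2^n$ and $P_K$ an $m\times n$ matrix with rows $v_{r+1},\dots,v_{r+m}\in\mathbf F_2^n$, such that $v_1,\dots,v_{r+m}$ are linearly independent. Put $V_{r'}=\operatorname{Span}\{v_1,\dots,v_{r'}\}$ and $$d_{r,m}=\min_{r\le r'<r+m} d_H(v_{r'+1},V_{r'}).$$ A partition is a triple $\mathcal P=(s,z,b)$ of strings in $\mathbf F_2^N$ with $|s|=n$, $|z|=n_z$, $|b|=n_x$ and $|s+z+b|=N$; it splits the $N$ positions into INFO, TEST-Z and TEST-X positions. A subscript $s$, $z$ or $b$ on a string denotes its substring at the corresponding positions. Write $|i^0\rangle$ ($i\in\{0,1\}$) for the computational ($z$) basis of $\mathbb C^2$, $|0^1\rangle=(|0^0\rangle+|1^0\rangle)/\sqrt2$ and $|1^1\rangle=(|0^0\rangle-|1^0\rangle)/\sqrt2$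 for the $x$ basis. A collective attack consists, for each $1\le j\le N$, of a finite-dimensional probe space $E_j$, a unit vector $|0^E\rangle_{E_j}\in E_j$ and a unitary $U_j$ on $E_j\otimes\mathbb C^2$; it does not depend on $\mathcal P$ or on the bits sent. In the protocol, $\mathcal P$ and Alice's string $\mathbf i\in\mathbf F_2^N$ are uniform and independent; Alice sends $|i_1^{b_1}\rangle,\dots,|i_N^{b_N}\rangle$; Eve applies $U_j$ to $|0^E\rangle_{E_j}|i_j^{b_j}\rangle$ and keeps $E_j$; Bob measures the $j$-th qubit in the basis $b_j$ and obtains $i^B_j$. The error string is $\mathbf c=\mathbf i+\mathbf i^B$. For $\mathbf x\in\mathbf F_2^n$ let $\rho_{\mathbf x}^{\mathbf b'}$, $\mathbf b'=b_s$, be the state of Eve's probes attached to the INFO qubits, after the attack, if the INFO bits sent are $\mathbf x$. For a syndrome $\xi\in\mathbf F_2^r$ and a key $\mathbf k\in\mathbf F_2^m$ let $$\widehat\rho_{\mathbf k}=\frac1{2^{\,n-r-m}}\sum_{\mathbf x:\ \mathbf xP_C^{T}=\xi,\ \mathbf xP_K^{T}=\mathbf k}\rho_{\mathbf x}^{\mathbf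 b'} .$$ Finally let $\widetilde{\mathbf C}_I$ be the string of errors on the INFO bits in the virtual experiment that differs from the protocol only in that the INFO bits are encoded and measured in the $x$ basis (string of bases $b+s$ instead of $b$). **Proposition.** For every such $P_C,P_K$, every collective attack, every partition $\mathcal P$, all $\mathbf c_z\in\mathbf F_2^{n_z}$ and $\mathbf c_b\in\mathbf F_2^{n_x}$ such that the event that the partition is $\mathcal P$ and the error strings on the TEST-Z and TEST-X bits are $\mathbf c_z$ and $\mathbf c_b$ has positive probability, every $\xi\in\mathbf F_2^r$ and any two keys $\mathbf k,\mathbf k'\in\mathbf F_2^m$, $$\tfrac12\operatorname{tr}\left|\widehat\rho_{\mathbf k}-\widehat\rho_{\mathbf k'}\right|\ \le\ 2m\sqrt{P\left[\,|\widetilde{\mathbf C}_I|\ge \tfrac{d_{r,m}}2\ \middle|\ \mathbf c_z,\mathbf c_b,\mathcal P\right]} .$$ (For $m=0$, where $d_{r,m}$ is a minimum over the empty set, both sides are $0$.) -/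

import Mathlib

open scoped Matrix MatrixOrder Matrix.Norms.L2Operator

noncomputable section

namespace BB84InfoZ

/-! ### Bit strings -/

/-- Bit strings of length `t`, i.e. elements of `𝐅₂ᵗ`.  The number of `1`-bits is `hammingNorm`
and the Hamming distance is `hammingDist`. -/
abbrev Bits (t : ℕ) : Type := Fin t → ZMod 2

/-- The set of positions of the `1`-bits of `s`. -/
def ones {N : ℕ} (s : Bits N) : Finset (Fin N) := Finset.univ.filter fun j => s j ≠ 0

/-- The increasing enumeration of the positions of the `1`-bits of a string `s` with `|s| = t`. -/
def pos {N t : ℕ} (s : Bits N) (hs : hammingNorm s = t) : Fin t ↪o Fin N :=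
  (ones s).orderEmbOfFin hs

/-- The substring `i_s` of `i`, made of the bits of `i` at the positions where `s` is `1`. -/
def substring {N t : ℕ} (s : Bits N) (hs : hammingNorm s = t) (i : Bits N) : Bits t :=
  fun l => i (pos s hs l)

/-! ### The linear codes -/

/-- The vectors `v₁, …, v_{r+m}`: the rows of `P_C` followed by the rows of `P_K`.  The index is
shifted by one, so `rows PC PK i` is `v_{i+1}`. -/
def rows {n r m : ℕ} (PC : Matrix (Fin r) (Fin n) (ZMod 2))
    (PK : Matrix (Fin m) (Fin n) (ZMod 2)) : Fin (r + m) → Bits n :=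
  Fin.append (fun i => PC i) (fun i => PK i)

/-- Hamming distance from a vector to a subspace. -/
def distToSubspace {n : ℕ} (v : Bits n) (V : Submodule (ZMod 2) (Bits n)) : ℕ :=
  sInf {d | ∃ w ∈ V, d = hammingDist v w}

/-- `d_{r,m} = min_{r ≤ r' < r+m} d_H(v_{r'+1}, V_{r'})` with `V_{r'} = Span {v₁, …, v_{r'}}`. -/
def minDist {n r m : ℕ} (PC : Matrix (Fin r) (Fin n) (ZMod 2))
    (PK : Matrix (Fin m) (Fin n) (ZMod 2)) : ℕ :=
  sInf {d | ∃ r' : Fin (r + m), r ≤ (r' : ℕ) ∧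
    d = distToSubspace (rows PC PK r')
      (Submodule.span (ZMod 2) (rows PC PK '' {i | i < r'}))}

/-! ### Partitions of the transmitted bits -/

/-- Partitions `𝒫 = (s, z, b)` of the `N = n + n_z + n_x` bits: `|s| = n`, `|z| = n_z`,
`|b| = n_x` and `|s + z + b| = N`. -/
def Partition (n nz nx : ℕ) : Type :=
  {p : Bits (n + nz + nx) × Bits (n + nz + nx) × Bits (n + nz + nx) //
    hammingNorm p.1 = n ∧ hammingNorm p.2.1 = nz ∧ hammingNorm p.2.2 = nx ∧
      hammingNorm (p.1 + p.2.1 + p.2.2) = n + nz + nx}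

namespace Partition

variable {n nz nx : ℕ}

instance : Fintype (Partition n nz nx) := Subtype.fintype _

/-- The string marking the INFO bits. -/
def s (P : Partition n nz nx) : Bits (n + nz + nx) := P.1.1

/-- The string marking the TEST-Z bits. -/
def z (P : Partition n nz nx) : Bits (n + nz + nx) := P.1.2.1

/-- The string marking the TEST-X bits; it is also the string of bases used in the protocol
(`0` for the `z` basis, `1` for the `x` basis). -/
def b (P : Partition n nz nx) : Bits (n + nz + nx) := P.1.2.2

/-- The INFO substring of an `N`-bit string. -/
def info (P : Partition n nz nx) (i : Bits (n + nz + nx)) : Bits n :=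
  substring P.s P.2.1 i

/-- The TEST-Z substring of an `N`-bit string. -/
def testZ (P : Partition n nz nx) (i : Bits (n + nz + nx)) : Bits nz :=
  substring P.z P.2.2.1 i

/-- The TEST-X substring of an `N`-bit string. -/
def testX (P : Partition n nz nx) (i : Bits (n + nz + nx)) : Bits nx :=
  substring P.b P.2.2.2.1 i

/-- The position in the `N`-bit string of the `l`-th INFO bit. -/
def infoPos (P : Partition n nz nx) (l : Fin n) : Fin (n + nz + nx) := pos P.s P.2.1 l

/-- The string of bases in the virtual experiment in which the INFO bits are encoded (and
measured) in the `x` basis, everything else being as in the protocol. -/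
def conjBasis (P : Partition n nz nx) : Bits (n + nz + nx) := P.b + P.s

end Partition

/-! ### Qubits and the collective attack -/

/-- The qubit state `|i^c⟩`: bit `i` encoded in the `z` basis (`c = 0`) or the `x` basis
(`c = 1`), as a vector of coordinates in the computational basis. -/
def qubit (c i : ZMod 2) : ZMod 2 → ℂ :=
  if c = 0 then Pi.single i 1
  else fun t => (if i = 1 ∧ t = 1 then -1 else 1) / (Real.sqrt 2 : ℂ)

/-- A collective attack on `N` qubits: for every `j`, a probe space `ℂ^{dim j}`, an initial
(unit) probe state `|0^E⟩_{E_j}` and a unitary `U_j` on `ℂ^{dim j} ⊗ ℂ²`. -/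
structure CollectiveAttack (N : ℕ) where
  dim : Fin N → ℕ
  probe : ∀ j, Fin (dim j) → ℂ
  probe_normalized : ∀ j, ∑ a, ‖probe j a‖ ^ 2 = 1
  U : ∀ j, Matrix (Fin (dim j) × ZMod 2) (Fin (dim j) × ZMod 2) ℂ
  U_unitary : ∀ j, U j ∈ Matrix.unitaryGroup (Fin (dim j) × ZMod 2) ℂ

namespace CollectiveAttack

variable {N : ℕ} (A : CollectiveAttack N)

/-- The joint state `U_j |0^E⟩_{E_j} |i^c⟩_{T_j}` after the attack on the `j`-th qubit. -/
def joint (j : Fin N) (c i : ZMod 2) : Fin (A.dim j) × ZMod 2 → ℂ :=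
  A.U j *ᵥ fun p => A.probe j p.1 * qubit c i p.2

/-- The non-normalized probe state `|E^c_{i y}⟩ = ⟨y^c|_{T_j} U_j |0^E⟩_{E_j} |i^c⟩_{T_j}`. -/
def eveVec (j : Fin N) (c i y : ZMod 2) : Fin (A.dim j) → ℂ :=
  fun a => ∑ t, star (qubit c y t) * A.joint j c i (a, t)

/-- The probability that Bob measures the bit `y` on the `j`-th qubit, if Alice sent the bit `i`
and both used the basis `c`. -/
def bobProb (j : Fin N) (c i y : ZMod 2) : ℝ := ∑ a, ‖A.eveVec j c i y a‖ ^ 2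

/-- The state of Eve's `j`-th probe after the attack, if Alice sent `|i^c⟩`: the partial trace
over `T_j` of the joint state. -/
def eveState (j : Fin N) (c i : ZMod 2) : Matrix (Fin (A.dim j)) (Fin (A.dim j)) ℂ :=
  Matrix.of fun a a' => ∑ t, A.joint j c i (a, t) * star (A.joint j c i (a', t))

end CollectiveAttack

/-! ### Eve's states -/

section EveStates

variable {n nz nx r m : ℕ}

/-- Index set of the product basis of the space `⊗_{j ∈ I} E_j` of Eve's probes attached to the
INFO qubits. -/
abbrev ProbeIndex (A : CollectiveAttack (n + nz + nx)) (P : Partition n nz nx) : Type :=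
  ∀ l : Fin n, Fin (A.dim (P.infoPos l))

/-- Eve's state `ρ_x^{b'}` after the attack, if Alice sent the INFO string `x` in the bases `b'`:
the tensor product of the states of the probes attached to the INFO qubits. -/
def rhoInfo (A : CollectiveAttack (n + nz + nx)) (P : Partition n nz nx) (b' x : Bits n) :
    Matrix (ProbeIndex A P) (ProbeIndex A P) ℂ :=
  Matrix.of fun a a' => ∏ l, A.eveState (P.infoPos l) (b' l) (x l) (a l) (a' l)

/-- Eve's state `ρ̂_k` corresponding to the final key `k`, given the syndrome `ξ`:
the mixture of the states `ρ_x^{b'}` with `b' = b_s`, `x P_Cᵀ = ξ` and `x P_Kᵀ = k`. -/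
def rhoHat (A : CollectiveAttack (n + nz + nx)) (P : Partition n nz nx)
    (PC : Matrix (Fin r) (Fin n) (ZMod 2)) (PK : Matrix (Fin m) (Fin n) (ZMod 2))
    (ξ : Bits r) (k : Bits m) : Matrix (ProbeIndex A P) (ProbeIndex A P) ℂ :=
  ((2 : ℂ) ^ (n - r - m))⁻¹ •
    ∑ x : Bits n with x ᵥ* PCᵀ = ξ ∧ x ᵥ* PKᵀ = k, rhoInfo A P (P.info P.b) x

/-- `tr |M|`, where `|M| = √(Mᴴ M)`. -/
def trAbs {ι : Type*} [Fintype ι] [DecidableEq ι] (M : Matrix ι ι ℂ) : ℝ :=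
  (Matrix.trace (CFC.sqrt (Mᴴ * M))).re

end EveStates

/-! ### Probabilities -/

section Probability

variable {n nz nx : ℕ}

/-- Outcomes of an experiment: the partition `𝒫`, the string `i` sent by Alice and the string
`i^B` measured by Bob. -/
abbrev Outcome (n nz nx : ℕ) : Type :=
  Partition n nz nx × Bits (n + nz + nx) × Bits (n + nz + nx)

/-- The joint law of `(𝒫, i, i^B)` under the attack `A`, if Alice encodes and Bob measures in the
string of bases `basis 𝒫`: the partition `𝒫` and the string `i` are uniform and independent, and
the qubits are attacked and measured one by one. The protocol is the case
`basis = Partition.b`. -/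
def law (A : CollectiveAttack (n + nz + nx)) (basis : Partition n nz nx → Bits (n + nz + nx))
    (ω : Outcome n nz nx) : ℝ :=
  (Fintype.card (Partition n nz nx) : ℝ)⁻¹ * ((2 : ℝ) ^ (n + nz + nx))⁻¹ *
    ∏ j, A.bobProb j (basis ω.1 j) (ω.2.1 j) (ω.2.2 j)

open Classical in
/-- The probability of the event `E` under the weights `w`. -/
def prob {Ω : Type*} [Fintype Ω] (w : Ω → ℝ) (E : Set Ω) : ℝ := ∑ ω with ω ∈ E, w ω

/-- The conditional probability of `E` given `F` under the weights `w`
(meaningful if `F` has positive probability). -/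
def condProb {Ω : Type*} [Fintype Ω] (w : Ω → ℝ) (E F : Set Ω) : ℝ :=
  prob w (E ∩ F) / prob w F

/-- The error string `c = i + i^B`. -/
def errors (ω : Outcome n nz nx) : Bits (n + nz + nx) := ω.2.1 + ω.2.2

/-- The event that the partition is `P`, the errors on the TEST-Z bits are `cz` and the errors on
the TEST-X bits are `cb`. -/
def testEvent (P : Partition n nz nx) (cz : Bits nz) (cb : Bits nx) : Set (Outcome n nz nx) :=
  {ω | ω.1 = P ∧ ω.1.testZ (errors ω) = cz ∧ ω.1.testX (errors ω) = cb}

/-- The event that the number of errors on the INFO bits is at least `t`. -/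
def infoErrorEvent (t : ℝ) : Set (Outcome n nz nx) :=
  {ω | t ≤ (hammingNorm (ω.1.info (errors ω)) : ℝ)}

end Probability

end BB84InfoZ

end

open scoped Kronecker

namespace BB84InfoZ

/-! A Hermitian difference of states has trace norm `Re tr (W D)` for some contraction `W`, so it
suffices to compare averages of `f x = tr (W ρ_x)` over the two cosets of strings compatible with
the keys.

Information-disturbance: Eve's state for INFO string `x`, sent in the `z` basis, has a purification
`φ_x = ∑ c, (-1)^(x·c) η_c` whose vectors `η_c` are pairwise orthogonal, with `‖η_c‖²` the
probability of the error string `c` when the INFO bits use the `x` basis (`exists_infoErrVec`). It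
is a tensor product of one-qubit purifications (`exists_orthogonal_purification`, `errProb_one`).

Code distance: impose the key parities one at a time. Passing from `i` to `i + 1` parities changes
the average of `f` by at most the average of `(-1)^(x·v) f x`, with `v` the new row
(`norm_cosetAvg_sub_le`). Expand `f x = ⟨φ_x, T φ_x⟩`, where `T = W ⊗ 1`. Two error strings `c`,
`c'` of weight below `d/2` contribute the character of `v + c + c'`, which lies outside the span of
the earlier rows and so sums to zero on the coset. What remains contains a heavy component and is at
most `2√P(heavy)` (`norm_sum_sgn_inner_le`). Over `m` steps, both keys stay close to the same
average, the one fixed by the syndrome alone. Independence of the qubits removes the conditioning on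
the tests (`condProb_infoErrorEvent`). -/

/-! ### The trace norm -/

/-- The trace norm of a Hermitian matrix is attained by a contraction. -/
theorem exists_trAbs_eq {ι : Type*} [Fintype ι] [DecidableEq ι] {D : Matrix ι ι ℂ}
    (hD : D.IsHermitian) : ∃ W : Matrix ι ι ℂ, ‖W‖ ≤ 1 ∧ trAbs D = (Matrix.trace (W * D)).re := by
  have hD' : IsSelfAdjoint D := hD
  have hfin : ∀ f : ℝ → ℝ, ContinuousOn f (spectrum ℝ D) := fun f =>
    (Matrix.finite_real_spectrum (A := D)).continuousOn f
  -- `W` is the sign of `D`; the jump at `0` is harmless because the spectrum is finite.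
  refine ⟨cfc (fun x : ℝ => (SignType.sign x : ℝ)) D, norm_cfc_le zero_le_one fun x _ => ?_, ?_⟩
  · rcases lt_trichotomy x 0 with h | h | h <;> simp [h]
  · have h1 : CFC.abs D = cfc (fun x : ℝ => (SignType.sign x : ℝ)) D * D := by
      calc CFC.abs D = cfc (fun x : ℝ => (SignType.sign x : ℝ) * x) D := by
            rw [CFC.abs_eq_cfc_norm D]; simp [sign_mul_self]
        _ = _ := by
            rw [cfc_mul _ _ D (hfin _) (hfin _), cfc_id' ℝ D]
    rw [← h1]; rfl

/-- Tensoring with the identity does not increase the operator norm. -/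
theorem norm_kronecker_one_le {ι κ : Type*} [Fintype ι] [DecidableEq ι] [Fintype κ]
    [DecidableEq κ] (W : Matrix ι ι ℂ) : ‖W ⊗ₖ (1 : Matrix κ κ ℂ)‖ ≤ ‖W‖ := by
  -- Star homomorphisms of C⋆-algebras are contractive.
  let F : Matrix ι ι ℂ →⋆ₙₐ[ℂ] Matrix (ι × κ) (ι × κ) ℂ :=
    { toFun := fun M => M ⊗ₖ (1 : Matrix κ κ ℂ)
      map_smul' := fun c M => by simp [Matrix.smul_kronecker]
      map_zero' := by simp
      map_add' := fun M N => by simp [Matrix.add_kronecker]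
      map_mul' := fun M N => by rw [← Matrix.mul_kronecker_mul, one_mul]
      map_star' := fun M => by simp [Matrix.star_eq_conjTranspose, Matrix.conjTranspose_kronecker] }
  exact NonUnitalStarAlgHom.norm_apply_le F W

/-- If `ρ` is the partial trace of `|φ⟩⟨φ|`, then `tr (W ρ) = ⟨φ|W ⊗ 1|φ⟩`. -/
theorem trace_mul_partialTrace {ι κ : Type*} [Fintype ι] [DecidableEq ι] [Fintype κ]
    [DecidableEq κ] (W ρ : Matrix ι ι ℂ) (φ : EuclideanSpace ℂ (ι × κ))
    (h : ∀ a a', ρ a a' = ∑ t, φ (a, t) * star (φ (a', t))) :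
    Matrix.trace (W * ρ) =
      inner ℂ φ (Matrix.toEuclideanCLM (𝕜 := ℂ) (W ⊗ₖ (1 : Matrix κ κ ℂ)) φ) := by
  simp only [Matrix.trace, Matrix.diag, Matrix.mul_apply, h, PiLp.inner_apply,
    Matrix.ofLp_toEuclideanCLM, Matrix.mulVec, dotProduct, Fintype.sum_prod_type,
    Matrix.kroneckerMap_apply, Matrix.one_apply, RCLike.inner_apply]
  simp only [mul_ite, mul_one, mul_zero, ite_mul, zero_mul, Finset.sum_ite_eq, Finset.mem_univ,
    if_true, Finset.mul_sum, Finset.sum_mul]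
  refine Finset.sum_congr rfl fun a _ => ?_
  rw [Finset.sum_comm]
  refine Finset.sum_congr rfl fun t _ => Finset.sum_congr rfl fun a' _ => ?_
  simp; ring

/-! ### Characters of `𝐅₂ⁿ` -/

/-- The nontrivial character `u ↦ (-1)ᵘ` of `𝐅₂`. -/
noncomputable def sgn : AddChar (ZMod 2) ℂ where
  toFun u := if u = 0 then 1 else -1
  map_zero_eq_one' := by simp
  map_add_eq_mul' := by
    intro a b
    have h2 : (1 : ZMod 2) + 1 = 0 := by decide
    have h (u : ZMod 2) : u = 0 ∨ u = 1 := by revert u; decide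
    rcases h a with rfl | rfl <;> rcases h b with rfl | rfl <;> simp [h2]

@[simp] theorem sgn_one : sgn 1 = -1 := rfl

theorem zmod_two_cases (u : ZMod 2) : u = 0 ∨ u = 1 := by revert u; decide

@[simp] theorem sgn_mul_self (u : ZMod 2) : sgn u * sgn u = 1 := by
  rcases zmod_two_cases u with rfl | rfl <;> simp

@[simp] theorem norm_sgn (u : ZMod 2) : ‖sgn u‖ = 1 := by
  rcases zmod_two_cases u with rfl | rfl <;> simp

@[simp] theorem conj_sgn (u : ZMod 2) : (starRingEnd ℂ) (sgn u) = sgn u := by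
  rcases zmod_two_cases u with rfl | rfl <;> simp

theorem sgn_dotProduct {n : ℕ} (x c : Bits n) : sgn (x ⬝ᵥ c) = ∏ l, sgn (x l * c l) := by
  exact map_prod sgn.toMonoidHom (fun l => Multiplicative.ofAdd (x l * c l)) Finset.univ

/-- The strings with prescribed parities with respect to the first `i` vectors `v`. -/
def coset {n K : ℕ} (v : Fin K → Bits n) (g : Fin K → ZMod 2) (i : ℕ) : Finset (Bits n) :=
  Finset.univ.filter fun x => ∀ j : Fin K, (j : ℕ) < i → x ⬝ᵥ v j = g j

/-- A character sum over a coset vanishes if the character is nontrivial on it. -/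
theorem sum_coset_sgn_eq_zero {n K : ℕ} (v : Fin K → Bits n) (g : Fin K → ZMod 2) (i : ℕ)
    {u : Bits n} (hu : u ∉ Submodule.span (ZMod 2) (v '' {j | (j : ℕ) < i})) :
    ∑ x ∈ coset v g i, sgn (x ⬝ᵥ u) = 0 := by
  -- A functional that kills the span but not `u` is pairing with some `y`. Translation by `y`
  -- preserves the coset and flips every sign, so the sum equals its own negative.
  obtain ⟨f, hfu, hf⟩ := Submodule.exists_le_ker_of_notMem hu
  obtain ⟨y, hy⟩ : ∃ y : Bits n, ∀ w, f w = y ⬝ᵥ w := by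
    refine ⟨fun l => f (Pi.single l 1), fun w => ?_⟩
    conv_lhs => rw [LinearMap.pi_apply_eq_sum_univ f w]
    simp only [dotProduct, smul_eq_mul, mul_comm]
    refine Finset.sum_congr rfl fun l _ => ?_
    congr 2
    ext l'; simp [Pi.single_apply, eq_comm]
  have hyu : y ⬝ᵥ u = 1 := by
    rw [← hy]; rcases zmod_two_cases (f u) with h | h
    · exact absurd h hfu
    · exact h
  have hyv : ∀ j : Fin K, (j : ℕ) < i → y ⬝ᵥ v j = 0 := fun j hj => by
    rw [← hy]; exact hf (Submodule.subset_span ⟨j, hj, rfl⟩)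
  have key : ∑ x ∈ coset v g i, sgn (x ⬝ᵥ u) = ∑ x ∈ coset v g i, sgn ((x + y) ⬝ᵥ u) := by
    symm
    refine Finset.sum_bij (fun x _ => x + y) ?_ ?_ ?_ ?_
    · intro x hx
      simp only [coset, Finset.mem_filter, Finset.mem_univ, true_and] at hx ⊢
      intro j hj; rw [add_dotProduct, hx j hj, hyv j hj, add_zero]
    · intro a _ b _ h; exact add_right_cancel h
    · intro x hx
      refine ⟨x - y, ?_, sub_add_cancel x y⟩
      simp only [coset, Finset.mem_filter, Finset.mem_univ, true_and] at hx ⊢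
      intro j hj; rw [sub_dotProduct, hx j hj, hyv j hj, sub_zero]
    · intros; rfl
  simp only [add_dotProduct, hyu, AddChar.map_add_eq_mul, sgn_one, mul_neg, mul_one,
    Finset.sum_neg_distrib] at key
  linear_combination key / 2

theorem coset_zero {n K : ℕ} (v : Fin K → Bits n) (g : Fin K → ZMod 2) :
    coset v g 0 = Finset.univ := by simp [coset]

/-- Imposing one more parity, on the level of sums. -/
theorem two_mul_sum_coset_succ {n K : ℕ} (v : Fin K → Bits n) (g : Fin K → ZMod 2) (i : Fin K)
    (f : Bits n → ℂ) :
    2 * ∑ x ∈ coset v g (i + 1), f x =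
      ∑ x ∈ coset v g i, f x + sgn (g i) * ∑ x ∈ coset v g i, sgn (x ⬝ᵥ v i) * f x := by
  have h : coset v g (i + 1) = (coset v g i).filter fun x => x ⬝ᵥ v i = g i := by
    ext x
    simp only [coset, Finset.mem_filter, Finset.mem_univ, true_and, Order.lt_add_one_iff]
    refine ⟨fun h => ⟨fun j hj => h j hj.le, h i le_rfl⟩, fun h j hj => ?_⟩
    rcases hj.lt_or_eq with hj | hj
    · exact h.1 j hj
    · rw [Fin.ext hj]; exact h.2
  rw [h, Finset.sum_filter, Finset.mul_sum, Finset.mul_sum, ← Finset.sum_add_distrib]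
  refine Finset.sum_congr rfl fun x _ => ?_
  -- Pointwise, twice the indicator of `x ⬝ᵥ v i = g i` is `1 + sgn (g i) * sgn (x ⬝ᵥ v i)`.
  rcases zmod_two_cases (x ⬝ᵥ v i) with h | h <;> rcases zmod_two_cases (g i) with h' | h' <;>
    simp [h, h'] <;> ring

/-- By independence each new row gives a nontrivial character on the current coset, so each parity
halves it. This justifies the normalization `2 ^ i / 2 ^ n` of `cosetAvg`. -/
theorem card_coset_mul {n K : ℕ} {v : Fin K → Bits n} (hv : LinearIndependent (ZMod 2) v)
    (g : Fin K → ZMod 2) (i : ℕ) (hi : i ≤ K) : ((coset v g i).card : ℂ) * 2 ^ i = 2 ^ n := by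
  induction i with
  | zero => simp [coset_zero]
  | succ i ih =>
    have h := two_mul_sum_coset_succ v g ⟨i, hi⟩ fun _ => 1
    simp only [mul_one] at h
    rw [sum_coset_sgn_eq_zero] at h
    · rw [← ih (by omega), pow_succ]
      simp only [Finset.sum_const, nsmul_eq_mul, mul_one, mul_zero, add_zero] at h
      linear_combination 2 ^ i * h
    · refine hv.notMem_span_image ?_
      simp

/-- The average of `f` over a coset. -/
noncomputable def cosetAvg {n K : ℕ} (v : Fin K → Bits n) (g : Fin K → ZMod 2) (f : Bits n → ℂ) (i : ℕ) : ℂ :=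
  2 ^ i / 2 ^ n * ∑ x ∈ coset v g i, f x

/-- Telescoping over the parities: each increment is, up to sign, the signed average of `f` over the
previous coset. -/
theorem norm_cosetAvg_sub_le {n K : ℕ} {v : Fin K → Bits n}
    (hv : LinearIndependent (ZMod 2) v) (g : Fin K → ZMod 2) (f : Bits n → ℂ) {B : ℝ} (r m : ℕ)
    (hm : r + m ≤ K)
    (hB : ∀ i : Fin K, r ≤ (i : ℕ) →
      ‖∑ x ∈ coset v g i, sgn (x ⬝ᵥ v i) * f x‖ ≤ (coset v g i).card * B) :
    ‖cosetAvg v g f (r + m) - cosetAvg v g f r‖ ≤ m * B := by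
  induction m with
  | zero => simp
  | succ m ih =>
    have h := two_mul_sum_coset_succ v g ⟨r + m, hm⟩ f
    have hc := card_coset_mul hv g (r + m) (by omega)
    have hb := hB ⟨r + m, hm⟩ (by simp)
    simp only at h hb
    have h1 : cosetAvg v g f (r + m + 1) - cosetAvg v g f (r + m) = 2 ^ (r + m) / 2 ^ n *
        (sgn (g ⟨r + m, hm⟩) *
          ∑ x ∈ coset v g (r + m), sgn (x ⬝ᵥ v ⟨r + m, hm⟩) * f x) := by
      simp only [cosetAvg, pow_succ]
      linear_combination (2 ^ (r + m) / 2 ^ n) * h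
    have h2 : ‖cosetAvg v g f (r + m + 1) - cosetAvg v g f (r + m)‖ ≤ B := by
      rw [h1, norm_mul, norm_mul, norm_sgn, one_mul]
      have hc' : ((coset v g (r + m)).card : ℝ) * 2 ^ (r + m) = 2 ^ n := by exact_mod_cast hc
      calc _ ≤ ‖(2 ^ (r + m) / 2 ^ n : ℂ)‖ * ((coset v g (r + m)).card * B) := by gcongr
        _ = ((coset v g (r + m)).card * 2 ^ (r + m)) / 2 ^ n * B := by simp; ring
        _ = B := by rw [hc', div_self (by positivity), one_mul]
    calc _ = ‖(cosetAvg v g f (r + m + 1) - cosetAvg v g f (r + m)) +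
          (cosetAvg v g f (r + m) - cosetAvg v g f r)‖ := by rw [sub_add_sub_cancel, add_assoc]
      _ ≤ B + m * B := (norm_add_le _ _).trans (add_le_add h2 (ih (by omega)))
      _ = _ := by push_cast; ring

/-! ### The information-disturbance estimate -/

/-- If the frequencies in the complement of `H` do not interfere, then a signed sum of the
expectations of a contraction is controlled by the weight of the frequencies in `H`. -/
theorem norm_sum_sgn_inner_le {n K : ℕ} {E : Type*} [NormedAddCommGroup E]
    [InnerProductSpace ℂ E] (T : E →L[ℂ] E) (hT : ‖T‖ ≤ 1) (η : Bits n → E)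
    (horth : ∀ c c', c ≠ c' → inner ℂ (η c) (η c') = 0) (hone : ∑ c, ‖η c‖ ^ 2 = 1)
    (v : Fin K → Bits n) (g : Fin K → ZMod 2) (i : ℕ) (u : Bits n) (H : Finset (Bits n))
    (hH : ∀ c ∉ H, ∀ c' ∉ H,
      u + c + c' ∉ Submodule.span (ZMod 2) (v '' {j | (j : ℕ) < i})) :
    ‖∑ x ∈ coset v g i, sgn (x ⬝ᵥ u) *
        inner ℂ (∑ c, sgn (x ⬝ᵥ c) • η c) (T (∑ c, sgn (x ⬝ᵥ c) • η c))‖ ≤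
      (coset v g i).card * (2 * √(∑ c ∈ H, ‖η c‖ ^ 2)) := by
  -- Pythagoras: the signs do not affect the norm, so all bounds below are uniform in `x`.
  have hsq : ∀ (S : Finset (Bits n)) (x : Bits n),
      ‖∑ c ∈ S, sgn (x ⬝ᵥ c) • η c‖ ^ 2 = ∑ c ∈ S, ‖η c‖ ^ 2 := by
    intro S x
    have : (inner ℂ (∑ c ∈ S, sgn (x ⬝ᵥ c) • η c) (∑ c ∈ S, sgn (x ⬝ᵥ c) • η c) : ℂ) =
        ∑ c ∈ S, (‖η c‖ : ℂ) ^ 2 := by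
      rw [sum_inner]
      refine Finset.sum_congr rfl fun c hc => ?_
      rw [inner_sum, Finset.sum_eq_single_of_mem c hc]
      · rw [inner_smul_left, inner_smul_right, conj_sgn, ← mul_assoc, sgn_mul_self, one_mul,
          inner_self_eq_norm_sq_to_K]; rfl
      · intro c' _ h
        rw [inner_smul_left, inner_smul_right, horth c c' h.symm]; simp
    rw [inner_self_eq_norm_sq_to_K] at this
    exact Complex.ofReal_injective (by push_cast; exact this)
  set φ : Bits n → E := fun x => ∑ c, sgn (x ⬝ᵥ c) • η c
  set φH : Bits n → E := fun x => ∑ c ∈ H, sgn (x ⬝ᵥ c) • η c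
  set φL : Bits n → E := fun x => ∑ c ∈ Hᶜ, sgn (x ⬝ᵥ c) • η c with hφL
  have hadd : ∀ x, φ x = φH x + φL x := fun x => (Finset.sum_add_sum_compl H _).symm
  have hLL : ∑ x ∈ coset v g i, sgn (x ⬝ᵥ u) * inner ℂ (φL x) (T (φL x)) = 0 := by
    have : ∀ x, sgn (x ⬝ᵥ u) * inner ℂ (φL x) (T (φL x)) =
        ∑ c ∈ Hᶜ, ∑ c' ∈ Hᶜ, sgn (x ⬝ᵥ (u + c + c')) * inner ℂ (η c) (T (η c')) := by
      intro x
      simp only [hφL, map_sum, map_smul, sum_inner, inner_sum, inner_smul_left, inner_smul_right,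
        conj_sgn, Finset.mul_sum, dotProduct_add, AddChar.map_add_eq_mul]
      rw [Finset.sum_comm]
      refine Finset.sum_congr rfl fun c _ => Finset.sum_congr rfl fun c' _ => ?_
      ring
    simp only [this]
    rw [Finset.sum_comm]
    refine Finset.sum_eq_zero fun c hc => ?_
    rw [Finset.sum_comm]
    refine Finset.sum_eq_zero fun c' hc' => ?_
    rw [← Finset.sum_mul, sum_coset_sgn_eq_zero, zero_mul]
    exact hH c (Finset.mem_compl.1 hc) c' (Finset.mem_compl.1 hc')
  have hT' : ∀ a b : E, ‖(inner ℂ a (T b) : ℂ)‖ ≤ ‖a‖ * ‖b‖ := fun a b =>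
    (norm_inner_le_norm _ _).trans (by gcongr; simpa using T.le_of_opNorm_le hT b)
  have hnφ : ∀ x, ‖φ x‖ = 1 := fun x => by
    have := hsq Finset.univ x
    rw [hone] at this
    exact (pow_eq_one_iff_of_nonneg (norm_nonneg _) two_ne_zero).1 this
  have hnL : ∀ x, ‖φL x‖ ≤ 1 := fun x => by
    have h1 := hsq Hᶜ x
    have h2 : ∑ c ∈ Hᶜ, ‖η c‖ ^ 2 ≤ 1 := by
      rw [← hone]
      exact Finset.sum_le_sum_of_subset_of_nonneg (Finset.subset_univ _) fun _ _ _ => by positivity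
    rw [← h1] at h2
    exact (sq_le_one_iff₀ (norm_nonneg _)).1 h2
  have hnH : ∀ x, ‖φH x‖ = √(∑ c ∈ H, ‖η c‖ ^ 2) := fun x => by
    rw [← hsq H x, Real.sqrt_sq (norm_nonneg _)]
  -- Keeping `φ x` whole in the first term leaves two terms rather than three, each with one factor
  -- `φH x` and one factor of norm at most `1`; hence the constant `2`.
  have hsplit : ∀ x, inner ℂ (φ x) (T (φ x)) - inner ℂ (φL x) (T (φL x)) =
      inner ℂ (φH x) (T (φ x)) + inner ℂ (φL x) (T (φH x)) := fun x => by
    rw [hadd x]; simp only [map_add, inner_add_left, inner_add_right]; ring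
  calc _ = ‖∑ x ∈ coset v g i, sgn (x ⬝ᵥ u) *
          (inner ℂ (φH x) (T (φ x)) + inner ℂ (φL x) (T (φH x)))‖ := by
        simp only [← hsplit, mul_sub, Finset.sum_sub_distrib, hLL, sub_zero]
        rfl
    _ ≤ ∑ x ∈ coset v g i, 2 * √(∑ c ∈ H, ‖η c‖ ^ 2) := by
        refine norm_sum_le_of_le _ fun x _ => ?_
        rw [norm_mul, norm_sgn, one_mul]
        refine (norm_add_le _ _).trans ?_
        have h1 := hT' (φH x) (φ x)
        have h2 := hT' (φL x) (φH x)
        have h3 := mul_le_mul_of_nonneg_right (hnL x) (norm_nonneg (φH x))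
        rw [hnφ] at h1
        rw [← hnH x]; linarith
    _ = _ := by simp

/-! ### Error vectors of a single qubit -/

theorem sum_zmod_two {M : Type*} [AddCommMonoid M] (f : ZMod 2 → M) : ∑ t, f t = f 0 + f 1 :=
  Fin.sum_univ_two f

/-- Two states on `ℂ^D ⊗ ℂ²` have purifications of their partial traces whose half sum and half
difference are orthogonal, with the weights determined by the overlap of `ψ₀` and the flipped
`ψ₁`. -/
theorem exists_orthogonal_purification {D : Type*} [Fintype D] (ψ : ZMod 2 → D × ZMod 2 → ℂ)
    (hψ : ∀ i, ∑ p, star (ψ i p) * ψ i p = 1) :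
    ∃ η : ZMod 2 → D × (ZMod 2 × ZMod 2) → ℂ,
      (∀ i a a', ∑ t, ψ i (a, t) * star (ψ i (a', t)) =
        ∑ t, (∑ c, sgn (i * c) * η c (a, t)) * star (∑ c, sgn (i * c) * η c (a', t))) ∧
      ∀ c c', ∑ p, star (η c p) * η c' p = if c = c' then
        (1 + sgn c * (∑ p, star (ψ 0 p) * ψ 1 (p.1, p.2 + 1)).re) / 2 else 0 := by
  set z : ℂ := ∑ p, star (ψ 0 p) * ψ 1 (p.1, p.2 + 1) with hz
  have h11 : (1 : ZMod 2) + 1 = 0 := by decide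
  -- Half sum and half difference of unit vectors are orthogonal exactly when their overlap is real,
  -- so `w` rescales `z` to its real part. For `z = 0` the quotient defaults to `0`, which works.
  obtain ⟨w, hw, hw1⟩ : ∃ w : ℂ, z * w = z.re ∧ ‖w‖ ≤ 1 := by
    refine ⟨z.re / z, ?_, ?_⟩
    · by_cases h : z = 0
      · simp [h]
      · field_simp
    · rw [norm_div, Complex.norm_real]
      exact div_le_one_of_le₀ (Complex.abs_re_le_norm z) (norm_nonneg _)
  set q : ℂ := ((√(1 - ‖w‖ ^ 2) : ℝ) : ℂ) with hq
  have hq1 : star w * w + star q * q = 1 := by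
    have h1 : star w * w = ((‖w‖ ^ 2 : ℝ) : ℂ) := by
      push_cast; exact Complex.conj_mul' w
    have h2 : star q * q = ((1 - ‖w‖ ^ 2 : ℝ) : ℂ) := by
      rw [hq, Complex.star_def, Complex.conj_ofReal, ← Complex.ofReal_mul,
        Real.mul_self_sqrt]
      nlinarith [norm_nonneg w]
    rw [h1, h2]; push_cast; ring
  -- With an ancilla qubit, `ψ 0 ⊗ |0⟩` is combined with the flipped `ψ 1` tensored with the unit
  -- vector `w|0⟩ + q|1⟩`. Flip and ancilla act on the traced-out side only, so both partial traces
  -- survive.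
  refine ⟨fun c p => (ψ 0 (p.1, p.2.1) * (if p.2.2 = 0 then 1 else 0) +
    sgn c * ψ 1 (p.1, p.2.1 + 1) * (if p.2.2 = 0 then w else q)) / 2, ?_, ?_⟩
  · intro i a a'
    rcases zmod_two_cases i with rfl | rfl
    · simp only [Fintype.sum_prod_type, sum_zmod_two, h11]
      simp
      ring
    · simp only [Fintype.sum_prod_type, sum_zmod_two, h11]
      simp only [Complex.star_def] at hq1 ⊢
      have h2 : (starRingEnd ℂ) 2 = 2 := Complex.conj_ofNat 2
      simp [h2]
      linear_combination (-ψ 1 (a, 0) * (starRingEnd ℂ) (ψ 1 (a', 0)) -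
        ψ 1 (a, 1) * (starRingEnd ℂ) (ψ 1 (a', 1))) * hq1
  · intro c c'
    have hw' : star z * star w = z.re := by
      rw [← star_mul', hw, Complex.star_def, Complex.conj_ofReal]
    have h0 := hψ 0
    have h1 := hψ 1
    have hzs : star z = ∑ p, ψ 0 p * star (ψ 1 (p.1, p.2 + 1)) := by
      rw [hz, star_sum]; simp [mul_comm]
    have hflip : ∑ p : D × ZMod 2, star (ψ 1 (p.1, p.2 + 1)) * ψ 1 (p.1, p.2 + 1) = 1 := by
      rw [← h1]
      simp only [Fintype.sum_prod_type, sum_zmod_two, h11, zero_add]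
      exact Finset.sum_congr rfl fun a _ => add_comm _ _
    have key : ∑ p : D × (ZMod 2 × ZMod 2),
        star ((ψ 0 (p.1, p.2.1) * (if p.2.2 = 0 then 1 else 0) +
          sgn c * ψ 1 (p.1, p.2.1 + 1) * (if p.2.2 = 0 then w else q)) / 2) *
        ((ψ 0 (p.1, p.2.1) * (if p.2.2 = 0 then 1 else 0) +
          sgn c' * ψ 1 (p.1, p.2.1 + 1) * (if p.2.2 = 0 then w else q)) / 2) =
        (∑ p, star (ψ 0 p) * ψ 0 p + sgn c' * w * z + sgn c * star w * star z +
          sgn c * sgn c' * (star w * w + star q * q) *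
          ∑ p : D × ZMod 2, star (ψ 1 (p.1, p.2 + 1)) * ψ 1 (p.1, p.2 + 1)) / 4 := by
      rw [hzs, hz]
      simp only [Fintype.sum_prod_type, sum_zmod_two, h11, Finset.mul_sum, Finset.sum_div,
        ← Finset.sum_add_distrib]
      refine Finset.sum_congr rfl fun a _ => ?_
      simp
      ring
    rw [key, hflip, h0, hq1]
    rcases zmod_two_cases c with rfl | rfl <;> rcases zmod_two_cases c' with rfl | rfl <;>
      simp only [AddChar.map_zero_eq_one, sgn_one, if_true, zero_ne_one, one_ne_zero, if_false]
    · linear_combination (1/4) * hw + (1/4) * hw'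
    · linear_combination (-1/4) * hw + (1/4) * hw'
    · linear_combination (1/4) * hw - (1/4) * hw'
    · linear_combination (-1/4) * hw - (1/4) * hw'

namespace CollectiveAttack

variable {N : ℕ} (A : CollectiveAttack N)

/-- The probability of the error bit `c` on the `j`-th qubit, in the basis `d`. -/
noncomputable def errProb (j : Fin N) (d c : ZMod 2) : ℝ := (∑ i, A.bobProb j d i (i + c)) / 2

theorem star_joint_dotProduct_joint (j : Fin N) (c i : ZMod 2) :
    ∑ p, star (A.joint j c i p) * A.joint j c i p = ∑ t, star (qubit c i t) * qubit c i t := by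
  have hU : (A.U j)ᴴ * A.U j = 1 := (Matrix.mem_unitaryGroup_iff'.1 (A.U_unitary j))
  have h : star (A.joint j c i) ⬝ᵥ A.joint j c i =
      star (fun p : Fin (A.dim j) × ZMod 2 => A.probe j p.1 * qubit c i p.2) ⬝ᵥ
        fun p => A.probe j p.1 * qubit c i p.2 := by
    unfold joint
    rw [Matrix.star_mulVec, ← Matrix.dotProduct_mulVec, Matrix.mulVec_mulVec, hU,
      Matrix.one_mulVec]
  have hp : ∑ a, star (A.probe j a) * A.probe j a = 1 := by
    have := A.probe_normalized j
    simp only [Complex.star_def, Complex.conj_mul']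
    exact_mod_cast this
  calc _ = _ := h
    _ = (∑ a, star (A.probe j a) * A.probe j a) * ∑ t, star (qubit c i t) * qubit c i t := by
      simp only [dotProduct, Fintype.sum_prod_type, Finset.sum_mul_sum, Pi.star_apply, star_mul']
      exact Finset.sum_congr rfl fun a _ => Finset.sum_congr rfl fun t _ => by ring
    _ = _ := by rw [hp, one_mul]

theorem joint_one (j : Fin N) (i : ZMod 2) (p : Fin (A.dim j) × ZMod 2) :
    A.joint j 1 i p = (A.joint j 0 0 p + sgn i * A.joint j 0 1 p) / (√2 : ℝ) := by
  have h : (fun p : Fin (A.dim j) × ZMod 2 => A.probe j p.1 * qubit 1 i p.2) =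
      ((√2 : ℝ) : ℂ)⁻¹ • ((fun p : Fin (A.dim j) × ZMod 2 => A.probe j p.1 * qubit 0 0 p.2) +
        sgn i • fun p : Fin (A.dim j) × ZMod 2 => A.probe j p.1 * qubit 0 1 p.2) := by
    ext ⟨a, t⟩
    rcases zmod_two_cases i with rfl | rfl <;> rcases zmod_two_cases t with rfl | rfl <;>
      simp [qubit] <;> ring
  unfold joint
  rw [h, Matrix.mulVec_smul, Matrix.mulVec_add, Matrix.mulVec_smul]
  simp [div_eq_inv_mul]

/-- Averaging over Alice's bit kills the terms odd in `sgn i`. The surviving interference is between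
`ψ₀` and the flipped `ψ₁`, giving the very weights of `exists_orthogonal_purification`. -/
theorem errProb_one (j : Fin N) (c : ZMod 2) :
    (A.errProb j 1 c : ℂ) = (1 + sgn c *
      (∑ p, star (A.joint j 0 0 p) * A.joint j 0 1 (p.1, p.2 + 1)).re) / 2 := by
  have h11 : (1 : ZMod 2) + 1 = 0 := by decide
  have hs : ((√2 : ℝ) : ℂ) * ((√2 : ℝ) : ℂ) = 2 := by
    rw [← Complex.ofReal_mul, Real.mul_self_sqrt zero_le_two]; norm_num
  have hs0 : ((√2 : ℝ) : ℂ) ≠ 0 := by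
    intro h; rw [h] at hs; norm_num at hs
  set ψ₀ := A.joint j 0 0 with hψ₀
  set ψ₁ := A.joint j 0 1 with hψ₁
  have hE : ∀ i a, A.eveVec j 1 i (i + c) a =
      (ψ₀ (a, 0) + sgn i * ψ₁ (a, 0) +
        sgn (i + c) * (ψ₀ (a, 1) + sgn i * ψ₁ (a, 1))) / 2 := by
    intro i a
    have hq0 : star (qubit 1 (i + c) 0) = ((√2 : ℝ) : ℂ)⁻¹ := by simp [qubit]
    have hq1 : star (qubit 1 (i + c) 1) = sgn (i + c) * ((√2 : ℝ) : ℂ)⁻¹ := by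
      rcases zmod_two_cases (i + c) with h | h <;> simp [qubit, h, neg_div]
    rw [eveVec, sum_zmod_two, hq0, hq1, joint_one, joint_one]
    field_simp
    rw [pow_two, hs]; ring
  have h0 : ∑ p, star (ψ₀ p) * ψ₀ p = 1 := by
    rw [hψ₀, star_joint_dotProduct_joint, sum_zmod_two]; simp [qubit]
  have h1 : ∑ p, star (ψ₁ p) * ψ₁ p = 1 := by
    rw [hψ₁, star_joint_dotProduct_joint, sum_zmod_two]; simp [qubit]
  set z : ℂ := ∑ p, star (ψ₀ p) * ψ₁ (p.1, p.2 + 1) with hz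
  have hre : (z.re : ℂ) = (z + star z) / 2 := by
    rw [Complex.star_def, Complex.add_conj]; push_cast; ring
  have hzs : star z = ∑ p, ψ₀ p * star (ψ₁ (p.1, p.2 + 1)) := by
    rw [hz, star_sum]; simp [mul_comm]
  have key : (A.errProb j 1 c : ℂ) = (∑ p, star (ψ₀ p) * ψ₀ p + ∑ p, star (ψ₁ p) * ψ₁ p +
      sgn c * (z + star z)) / 4 := by
    rw [hzs, hz]
    simp only [errProb, bobProb]
    push_cast
    simp only [← Complex.conj_mul', hE, Fintype.sum_prod_type, sum_zmod_two, h11, Finset.mul_sum,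
      Finset.sum_div, ← Finset.sum_add_distrib, AddChar.map_add_eq_mul]
    refine Finset.sum_congr rfl fun a _ => ?_
    have h2 : (starRingEnd ℂ) 2 = 2 := Complex.conj_ofNat 2
    rcases zmod_two_cases c with rfl | rfl <;> simp [h2] <;> ring
  rw [key, hre, h0, h1]; ring

theorem errProb_one_sum (j : Fin N) : ∑ c, A.errProb j 1 c = 1 := by
  have h : ((∑ c, A.errProb j 1 c : ℝ) : ℂ) = 1 := by
    push_cast
    rw [sum_zmod_two, errProb_one, errProb_one]; simp; ring
  exact_mod_cast h

theorem exists_errVec (j : Fin N) : ∃ η : ZMod 2 → Fin (A.dim j) × (ZMod 2 × ZMod 2) → ℂ,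
    (∀ i a a', A.eveState j 0 i a a' =
      ∑ t, (∑ c, sgn (i * c) * η c (a, t)) * star (∑ c, sgn (i * c) * η c (a', t))) ∧
    ∀ c c', ∑ p, star (η c p) * η c' p = if c = c' then (A.errProb j 1 c : ℂ) else 0 := by
  obtain ⟨η, h1, h2⟩ := exists_orthogonal_purification (fun i => A.joint j 0 i) fun i => by
    rw [star_joint_dotProduct_joint, sum_zmod_two]
    rcases zmod_two_cases i with rfl | rfl <;> simp [qubit]
  exact ⟨η, fun i a a' => h1 i a a', fun c c' => by rw [h2, errProb_one]⟩

end CollectiveAttack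

/-! ### Error vectors of the INFO string -/

variable {n nz nx : ℕ}

/-- Tensor product of the one-qubit vectors: the attack acts qubit by qubit, and characters, inner
products and partial traces all factor over positions. -/
theorem exists_infoErrVec (A : CollectiveAttack (n + nz + nx)) (P : Partition n nz nx) :
    ∃ η : Bits n → EuclideanSpace ℂ (ProbeIndex A P × (Fin n → ZMod 2 × ZMod 2)),
      (∀ x a a', rhoInfo A P 0 x a a' =
        ∑ t, (∑ c, sgn (x ⬝ᵥ c) • η c) (a, t) * star ((∑ c, sgn (x ⬝ᵥ c) • η c) (a', t))) ∧
      (∀ c c', c ≠ c' → inner ℂ (η c) (η c') = 0) ∧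
      ∀ c, ‖η c‖ ^ 2 = ∏ l, A.errProb (P.infoPos l) 1 (c l) := by
  choose η h1 h2 using fun l => A.exists_errVec (P.infoPos l)
  have hinner : ∀ c c' : Bits n,
      (inner ℂ (WithLp.toLp 2 fun p : ProbeIndex A P × (Fin n → ZMod 2 × ZMod 2) =>
        ∏ l, η l (c l) (p.1 l, p.2 l)) (WithLp.toLp 2 fun p => ∏ l, η l (c' l) (p.1 l, p.2 l)) :
        ℂ) = ∏ l, if c l = c' l then (A.errProb (P.infoPos l) 1 (c l) : ℂ) else 0 := by
    intro c c'
    have h2' : ∀ l c c', ∑ a, ∑ t, star (η l c (a, t)) * η l c' (a, t) =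
        if c = c' then (A.errProb (P.infoPos l) 1 c : ℂ) else 0 := fun l c c' => by
      rw [← h2, Fintype.sum_prod_type]
    simp only [← h2', PiLp.inner_apply, RCLike.inner_apply]
    rw [Fintype.prod_sum, Fintype.sum_prod_type]
    refine Finset.sum_congr rfl fun a _ => ?_
    rw [Fintype.prod_sum]
    refine Finset.sum_congr rfl fun t _ => ?_
    rw [map_prod, ← Finset.prod_mul_distrib]
    exact Finset.prod_congr rfl fun l _ => by simp [mul_comm]
  refine ⟨fun c => WithLp.toLp 2 fun p => ∏ l, η l (c l) (p.1 l, p.2 l), ?_, ?_, ?_⟩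
  · intro x a a'
    have hφ : ∀ p : ProbeIndex A P × (Fin n → ZMod 2 × ZMod 2),
        (∑ c, sgn (x ⬝ᵥ c) • (WithLp.toLp 2 fun p : ProbeIndex A P × (Fin n → ZMod 2 × ZMod 2) =>
          ∏ l, η l (c l) (p.1 l, p.2 l) : EuclideanSpace ℂ _)) p =
        ∏ l, ∑ c, sgn (x l * c) * η l c (p.1 l, p.2 l) := by
      intro p
      rw [Fintype.prod_sum]
      simp [sgn_dotProduct, Finset.prod_mul_distrib]
    simp only [hφ, rhoInfo, Matrix.of_apply, Pi.zero_apply, h1]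
    rw [Fintype.prod_sum]
    refine Finset.sum_congr rfl fun t _ => ?_
    rw [star_prod, ← Finset.prod_mul_distrib]
  · intro c c' h
    rw [hinner]
    obtain ⟨l, hl⟩ := Function.ne_iff.1 h
    exact Finset.prod_eq_zero (Finset.mem_univ l) (if_neg hl)
  · intro c
    have := hinner c c
    rw [inner_self_eq_norm_sq_to_K] at this
    simp only [if_true] at this
    exact Complex.ofReal_injective (by push_cast; exact this)

/-! ### Geometry of a partition -/

namespace Partition

/-- Subadditivity of the weight is an equality here, hence an equality at each position; since the
sum has full weight, exactly one of the three bits is `1` everywhere. -/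
theorem z_b_eq_zero_of_s_ne_zero (P : Partition n nz nx) {j : Fin (n + nz + nx)}
    (hj : P.s j ≠ 0) : P.z j = 0 ∧ P.b j = 0 := by
  obtain ⟨⟨s, z, b⟩, hs, hz, hb, h⟩ := P
  simp only [Partition.s, Partition.z, Partition.b] at hj ⊢
  simp only [hammingNorm, Finset.card_filter] at hs hz hb h
  have hle : ∀ j ∈ Finset.univ, (if (s + z + b) j ≠ 0 then 1 else 0) ≤
      (if s j ≠ 0 then 1 else 0) + (if z j ≠ 0 then 1 else 0) + (if b j ≠ 0 then 1 else 0) := by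
    intro j _
    rcases zmod_two_cases (s j) with h1 | h1 <;> rcases zmod_two_cases (z j) with h2 | h2 <;>
      rcases zmod_two_cases (b j) with h3 | h3 <;> simp [h1, h2, h3] <;> split_ifs <;> simp
  have hle' : ∀ j ∈ Finset.univ, (if (s + z + b) j ≠ 0 then 1 else 0) ≤ 1 := by
    intro j _; split_ifs <;> simp
  have h1 := (Finset.sum_eq_sum_iff_of_le hle).1
    (by rw [Finset.sum_add_distrib, Finset.sum_add_distrib, hs, hz, hb, h]) j (Finset.mem_univ j)
  have h2 := (Finset.sum_eq_sum_iff_of_le hle').1 (by rw [h]; simp) j (Finset.mem_univ j)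
  rw [h2, if_pos hj] at h1
  constructor <;> by_contra h3 <;> rw [if_pos h3] at h1 <;> omega

theorem pos_ne_zero {N t : ℕ} (s : Bits N) (hs : hammingNorm s = t) (l : Fin t) :
    s (pos s hs l) ≠ 0 := by
  have : pos s hs l ∈ ones s := Finset.orderEmbOfFin_mem _ _ _
  simpa [ones] using this

theorem s_infoPos (P : Partition n nz nx) (l : Fin n) : P.s (P.infoPos l) ≠ 0 :=
  pos_ne_zero P.s P.2.1 l

theorem info_b (P : Partition n nz nx) : P.info P.b = 0 :=
  funext fun l => (P.z_b_eq_zero_of_s_ne_zero (P.s_infoPos l)).2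

theorem conjBasis_infoPos (P : Partition n nz nx) (l : Fin n) :
    P.conjBasis (P.infoPos l) = 1 := by
  have h := P.s_infoPos l
  rw [conjBasis, Pi.add_apply, (P.z_b_eq_zero_of_s_ne_zero h).2, zero_add]
  exact (zmod_two_cases _).resolve_left h

theorem infoPos_injective (P : Partition n nz nx) : Function.Injective P.infoPos :=
  (pos P.s P.2.1).injective

theorem posZ_notMem_range (P : Partition n nz nx) (l : Fin nz) :
    pos P.z P.2.2.1 l ∉ Set.range P.infoPos := by
  rintro ⟨l', h⟩
  refine pos_ne_zero P.z P.2.2.1 l ?_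
  rw [← h]; exact (P.z_b_eq_zero_of_s_ne_zero (P.s_infoPos l')).1

theorem posX_notMem_range (P : Partition n nz nx) (l : Fin nx) :
    pos P.b P.2.2.2.1 l ∉ Set.range P.infoPos := by
  rintro ⟨l', h⟩
  refine pos_ne_zero P.b P.2.2.2.1 l ?_
  rw [← h]; exact (P.z_b_eq_zero_of_s_ne_zero (P.s_infoPos l')).2

end Partition

/-! ### The law of the error string -/

/-- Given the partition, the errors on the different qubits are independent. -/
theorem prob_law_eq (A : CollectiveAttack (n + nz + nx))
    (basis : Partition n nz nx → Bits (n + nz + nx)) (P : Partition n nz nx)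
    (G : Bits (n + nz + nx) → Prop) [DecidablePred G] :
    prob (law A basis) {ω | ω.1 = P ∧ G (errors ω)} =
      (Fintype.card (Partition n nz nx) : ℝ)⁻¹ *
        ∑ c, (if G c then 1 else 0) * ∏ j, A.errProb j (basis P j) (c j) := by
  have hadd : ∀ i c : Bits (n + nz + nx), i + (i + c) = c := by
    intro i c; ext j
    rcases zmod_two_cases (i j) with h | h <;> simp [h, ← add_assoc]
    decide
  rw [prob, Finset.sum_filter, Fintype.sum_prod_type, Finset.sum_eq_single P]
  · rw [Fintype.sum_prod_type]
    trans ∑ i, ∑ c, (if G c then 1 else 0) * law A basis (P, i, i + c)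
    · refine Finset.sum_congr rfl fun i _ => ?_
      -- Bob's string is reparametrized by the error string, so that the sum over Alice's bits
      -- factors and yields `2 * errProb` at each position.
      rw [← Equiv.sum_comp (Equiv.addLeft i)]
      refine Finset.sum_congr rfl fun c _ => ?_
      simp [errors, hadd]
    rw [Finset.sum_comm, Finset.mul_sum]
    refine Finset.sum_congr rfl fun c _ => ?_
    rw [← Finset.mul_sum]
    simp only [law, ← Finset.mul_sum, Pi.add_apply]
    rw [← Fintype.prod_sum fun j i => A.bobProb j (basis P j) i (i + c j)]
    have h2 : ∀ j, ∑ i, A.bobProb j (basis P j) i (i + c j) =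
        2 * A.errProb j (basis P j) (c j) := fun j => by rw [CollectiveAttack.errProb]; ring
    simp only [h2, Finset.prod_mul_distrib, Finset.prod_const, Finset.card_univ,
      Fintype.card_fin]
    field_simp
  · intro Q _ hQ
    exact Finset.sum_eq_zero fun y _ => if_neg fun h => hQ h.1
  · intro h; exact absurd (Finset.mem_univ P) h

/-- Sums of products over strings split according to a splitting of the positions. -/
theorem sum_mul_mul_prod_split {ι κ μ : Type*} [Fintype ι] [Fintype κ] [Fintype μ]
    [DecidableEq ι] [DecidableEq κ] [DecidableEq μ] (e : κ ⊕ μ ≃ ι) (q : ι → ZMod 2 → ℝ)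
    (Φ : (κ → ZMod 2) → ℝ) (Ψ : (μ → ZMod 2) → ℝ) :
    ∑ c : ι → ZMod 2, Φ (fun l => c (e (Sum.inl l))) * Ψ (fun l => c (e (Sum.inr l))) *
        ∏ j, q j (c j) =
      (∑ d, Φ d * ∏ l, q (e (Sum.inl l)) (d l)) * ∑ d, Ψ d * ∏ l, q (e (Sum.inr l)) (d l) := by
  rw [Finset.sum_mul_sum, ← Fintype.sum_prod_type']
  refine Fintype.sum_equiv ((e.arrowCongr (Equiv.refl (ZMod 2))).symm.trans
    (Equiv.sumArrowEquivProdArrow κ μ (ZMod 2))) _ _ fun c => ?_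
  rw [← e.prod_comp, Fintype.prod_sum_type]
  simp [Equiv.sumArrowEquivProdArrow, Equiv.arrowCongr, Function.comp_def]
  ring

open Classical in
/-- In the virtual experiment, the errors on the INFO bits are independent of those on the TEST
bits. -/
theorem condProb_infoErrorEvent (A : CollectiveAttack (n + nz + nx)) (P : Partition n nz nx)
    (cz : Bits nz) (cb : Bits nx)
    (hpos : 0 < prob (law A Partition.conjBasis) (testEvent P cz cb)) (t : ℝ) :
    condProb (law A Partition.conjBasis) (infoErrorEvent t) (testEvent P cz cb) =
      ∑ c : Bits n with t ≤ (hammingNorm c : ℝ), ∏ l, A.errProb (P.infoPos l) 1 (c l) := by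
  -- Positions split into INFO and the rest. Test positions lie in the rest, so the test condition
  -- is a function `Ψ` of that half alone and its probability cancels in the quotient.
  let e : Fin n ⊕ {j // j ∉ Set.range P.infoPos} ≃ Fin (n + nz + nx) :=
    ((Equiv.ofInjective _ P.infoPos_injective).sumCongr (Equiv.refl _)).trans
      (Equiv.sumCompl fun j => j ∈ Set.range P.infoPos)
  let Ψ : ({j // j ∉ Set.range P.infoPos} → ZMod 2) → ℝ := fun d =>
    if (fun l => d ⟨_, P.posZ_notMem_range l⟩) = cz ∧
      (fun l => d ⟨_, P.posX_notMem_range l⟩) = cb then 1 else 0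
  have hinl : ∀ l, e (Sum.inl l) = P.infoPos l := fun l => by simp [e]
  have hinr : ∀ l, e (Sum.inr l) = l := fun l => by simp [e]
  have hΨ : ∀ c : Bits (n + nz + nx), (if P.testZ c = cz ∧ P.testX c = cb then (1 : ℝ) else 0) =
      Ψ fun l => c (e (Sum.inr l)) := fun c => by
    simp only [Ψ, hinr]; rfl
  have hsplit := sum_mul_mul_prod_split e
    (fun j u => A.errProb j (P.conjBasis j) u) (Ψ := Ψ)
  simp only [hinl, hinr, P.conjBasis_infoPos] at hsplit
  have h1 : prob (law A Partition.conjBasis) (testEvent P cz cb) =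
      (Fintype.card (Partition n nz nx) : ℝ)⁻¹ *
        ∑ d, Ψ d * ∏ l : {j // j ∉ Set.range P.infoPos}, A.errProb l (P.conjBasis l) (d l) := by
    have : testEvent P cz cb = {ω | ω.1 = P ∧ (P.testZ (errors ω) = cz ∧
        P.testX (errors ω) = cb)} := by
      ext ⟨Q, i, y⟩
      simp only [testEvent, Set.mem_ofPred_eq]
      exact and_congr_right fun h => by subst h; rfl
    rw [this, prob_law_eq A _ P fun c => P.testZ c = cz ∧ P.testX c = cb]
    have h := hsplit fun _ => 1
    simp only [one_mul] at h
    simp only [hΨ, hinr]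
    rw [h, ← Fintype.prod_sum fun l u => A.errProb (P.infoPos l) 1 u]
    simp [A.errProb_one_sum]
  have h2 : prob (law A Partition.conjBasis) (infoErrorEvent t ∩ testEvent P cz cb) =
      (∑ c : Bits n with t ≤ (hammingNorm c : ℝ), ∏ l, A.errProb (P.infoPos l) 1 (c l)) *
        prob (law A Partition.conjBasis) (testEvent P cz cb) := by
    have : infoErrorEvent t ∩ testEvent P cz cb = {ω | ω.1 = P ∧
        (t ≤ (hammingNorm (P.info (errors ω)) : ℝ) ∧ (P.testZ (errors ω) = cz ∧
        P.testX (errors ω) = cb))} := by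
      ext ⟨Q, i, y⟩
      simp only [testEvent, infoErrorEvent, Set.mem_inter_iff, Set.mem_ofPred_eq]
      constructor
      · rintro ⟨ht, rfl, htest⟩; exact ⟨rfl, ht, htest⟩
      · rintro ⟨rfl, ht, htest⟩; exact ⟨ht, rfl, htest⟩
    rw [h1, this, prob_law_eq A _ P fun c => t ≤ (hammingNorm (P.info c) : ℝ) ∧
      (P.testZ c = cz ∧ P.testX c = cb), mul_left_comm, Finset.sum_filter]
    congr 1
    have h := hsplit fun d => if t ≤ (hammingNorm d : ℝ) then 1 else 0
    simp only [ite_mul, one_mul, zero_mul] at h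
    rw [← h]
    refine Finset.sum_congr rfl fun c _ => ?_
    have h3 := hΨ c
    simp only [hinr] at h3
    rw [← h3]
    by_cases h4 : t ≤ (hammingNorm (P.info c) : ℝ)
    · have h5 : t ≤ (hammingNorm fun l => c (P.infoPos l) : ℝ) := h4
      simp [h4, h5]
    · have h5 : ¬ t ≤ (hammingNorm fun l => c (P.infoPos l) : ℝ) := h4
      simp [h4, h5]
  rw [condProb, h2, mul_div_assoc, div_self hpos.ne', mul_one]

/-! ### The distance of the code -/

/-- The hypothesis exhibits a vector of the span that differs from the row by `c + c'`, whose weight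
is subadditive. -/
theorem minDist_le {r m : ℕ} (PC : Matrix (Fin r) (Fin n) (ZMod 2))
    (PK : Matrix (Fin m) (Fin n) (ZMod 2)) (i : Fin (r + m)) (hi : r ≤ (i : ℕ)) (c c' : Bits n)
    (h : rows PC PK i + c + c' ∈
      Submodule.span (ZMod 2) (rows PC PK '' {j | (j : ℕ) < i})) :
    minDist PC PK ≤ hammingNorm c + hammingNorm c' := by
  have h1 : minDist PC PK ≤ distToSubspace (rows PC PK i)
      (Submodule.span (ZMod 2) (rows PC PK '' {j | j < i})) := Nat.sInf_le ⟨i, hi, rfl⟩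
  have h2 : distToSubspace (rows PC PK i) (Submodule.span (ZMod 2) (rows PC PK '' {j | j < i})) ≤
      hammingDist (rows PC PK i) (rows PC PK i + c + c') := Nat.sInf_le ⟨_, h, rfl⟩
  refine (h1.trans h2).trans ?_
  rw [hammingDist_eq_hammingNorm]
  simp only [hammingNorm]
  refine (Finset.card_le_card fun j hj => ?_).trans (Finset.card_union_le _ _)
  simp only [Finset.mem_union, Finset.mem_filter, Finset.mem_univ, true_and, Pi.add_apply,
    Pi.neg_apply] at hj ⊢
  by_contra! hc
  exact hj (by rw [hc.1, hc.2, add_zero, add_zero, neg_add_cancel])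

theorem filter_syndrome_key_eq_coset {r m : ℕ} (PC : Matrix (Fin r) (Fin n) (ZMod 2))
    (PK : Matrix (Fin m) (Fin n) (ZMod 2)) (ξ : Bits r) (k : Bits m) :
    (Finset.univ.filter fun x : Bits n => x ᵥ* PCᵀ = ξ ∧ x ᵥ* PKᵀ = k) =
      coset (rows PC PK) (Fin.append ξ k) (r + m) := by
  ext x
  simp only [coset, Finset.mem_filter, Finset.mem_univ, true_and, Matrix.vecMul_transpose,
    funext_iff, Matrix.mulVec, dotProduct_comm _ x]
  constructor
  · rintro ⟨h1, h2⟩ j -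
    refine Fin.addCases (fun i => ?_) (fun i => ?_) j
    · simpa [rows] using h1 i
    · simpa [rows] using h2 i
  · intro h
    refine ⟨fun i => ?_, fun i => ?_⟩
    · simpa [rows] using h (Fin.castAdd m i) (Fin.is_lt _)
    · simpa [rows] using h (Fin.natAdd r i) (Fin.is_lt _)

theorem isHermitian_rhoHat {r m : ℕ} (A : CollectiveAttack (n + nz + nx)) (P : Partition n nz nx)
    (PC : Matrix (Fin r) (Fin n) (ZMod 2)) (PK : Matrix (Fin m) (Fin n) (ZMod 2))
    (ξ : Bits r) (k : Bits m) : (rhoHat A P PC PK ξ k).IsHermitian := by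
  ext a a'
  simp only [rhoHat, rhoInfo, CollectiveAttack.eveState, Matrix.conjTranspose_apply,
    Matrix.smul_apply, Matrix.sum_apply, Matrix.of_apply, star_smul, star_sum, star_prod,
    star_mul', star_star]
  simp [mul_comm]

end BB84InfoZ

/-! ### Combining the estimates for the two keys -/

open BB84InfoZ in
theorem mainTheorem4 {n nz nx r m : ℕ}
    (PC : Matrix (Fin r) (Fin n) (ZMod 2)) (PK : Matrix (Fin m) (Fin n) (ZMod 2))
    (hrows : LinearIndependent (ZMod 2) (BB84InfoZ.rows PC PK))
    (A : BB84InfoZ.CollectiveAttack (n + nz + nx))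
    (P : BB84InfoZ.Partition n nz nx)
    (cz : BB84InfoZ.Bits nz) (cb : BB84InfoZ.Bits nx)
    (hpos : 0 < BB84InfoZ.prob (BB84InfoZ.law A BB84InfoZ.Partition.conjBasis)
      (BB84InfoZ.testEvent P cz cb))
    (ξ : BB84InfoZ.Bits r) (k k' : BB84InfoZ.Bits m) :
    (1 / 2 : ℝ) * BB84InfoZ.trAbs
        (BB84InfoZ.rhoHat A P PC PK ξ k - BB84InfoZ.rhoHat A P PC PK ξ k') ≤
      2 * (m : ℝ) * Real.sqrt
        (BB84InfoZ.condProb (BB84InfoZ.law A BB84InfoZ.Partition.conjBasis)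
          (BB84InfoZ.infoErrorEvent ((BB84InfoZ.minDist PC PK : ℝ) / 2))
          (BB84InfoZ.testEvent P cz cb)) := by
  classical
  rw [condProb_infoErrorEvent A P cz cb hpos]
  set H : Finset (Bits n) :=
    Finset.univ.filter fun c => (minDist PC PK : ℝ) / 2 ≤ (hammingNorm c : ℝ) with hH
  obtain ⟨W, hW, htr⟩ := exists_trAbs_eq
    ((isHermitian_rhoHat A P PC PK ξ k).sub (isHermitian_rhoHat A P PC PK ξ k'))
  obtain ⟨η, hη, horth, hnorm⟩ := exists_infoErrVec A P
  have hone : ∑ c, ‖η c‖ ^ 2 = 1 := by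
    simp only [hnorm]
    rw [← Fintype.prod_sum fun l u => A.errProb (P.infoPos l) 1 u]
    simp [A.errProb_one_sum]
  set T := Matrix.toEuclideanCLM (𝕜 := ℂ)
    (Matrix.kronecker W (1 : Matrix (Fin n → ZMod 2 × ZMod 2) (Fin n → ZMod 2 × ZMod 2) ℂ))
  have hT : ‖T‖ ≤ 1 := (norm_kronecker_one_le W).trans hW
  set f : Bits n → ℂ := fun x => Matrix.trace (W * rhoInfo A P 0 x)
  have hfx : ∀ x, f x =
      inner ℂ (∑ c, sgn (x ⬝ᵥ c) • η c) (T (∑ c, sgn (x ⬝ᵥ c) • η c)) := fun x =>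
    trace_mul_partialTrace W _ _ fun a a' => hη x a a'
  have hrm : r + m ≤ n := by
    simpa using hrows.fintype_card_le_finrank
  have hhat : ∀ k, Matrix.trace (W * rhoHat A P PC PK ξ k) =
      cosetAvg (rows PC PK) (Fin.append ξ k) f (r + m) := by
    intro k
    have h2 : ((2 : ℂ) ^ (n - r - m))⁻¹ = 2 ^ (r + m) / 2 ^ n := by
      have : (2 : ℂ) ^ n = 2 ^ (r + m) * 2 ^ (n - r - m) := by
        rw [← pow_add]; congr 1; omega
      rw [this]; field_simp
    rw [rhoHat, filter_syndrome_key_eq_coset, P.info_b, cosetAvg, h2, Matrix.mul_smul,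
      Matrix.trace_smul, Matrix.mul_sum, Matrix.trace_sum, smul_eq_mul]
  have hbound : ∀ k, ‖cosetAvg (rows PC PK) (Fin.append ξ k) f (r + m) -
      cosetAvg (rows PC PK) (Fin.append ξ k) f r‖ ≤ m * (2 * √(∑ c ∈ H, ‖η c‖ ^ 2)) := by
    intro k
    refine norm_cosetAvg_sub_le hrows _ f r m le_rfl fun i hi => ?_
    simp only [hfx]
    refine norm_sum_sgn_inner_le T hT η horth hone _ _ i _ H fun c hc c' hc' hmem => ?_
    -- Two strings outside `H` have weights strictly below half the minimum distance, contradicting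
    -- this bound.
    have h := minDist_le PC PK i hi c c' hmem
    simp only [hH, Finset.mem_filter, Finset.mem_univ, true_and, not_le] at hc hc'
    have h' : (minDist PC PK : ℝ) ≤ hammingNorm c + hammingNorm c' := by exact_mod_cast h
    linarith
  -- The first `r` parities involve only the syndrome, so the hybrids for both keys start from the
  -- same average.
  have hcommon : cosetAvg (rows PC PK) (Fin.append ξ k) f r =
      cosetAvg (rows PC PK) (Fin.append ξ k') f r := by
    have : coset (rows PC PK) (Fin.append ξ k) r = coset (rows PC PK) (Fin.append ξ k') r := by
      refine Finset.filter_congr fun x _ => forall₂_congr fun j hj => ?_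
      have hj' : j = Fin.castAdd m ⟨j, hj⟩ := rfl
      rw [hj', Fin.append_left, Fin.append_left]
    rw [cosetAvg, cosetAvg, this]
  have hk := hbound k
  have hk' := hbound k'
  rw [← hcommon] at hk'
  simp only [hnorm] at hk hk'
  have hfin : trAbs (rhoHat A P PC PK ξ k - rhoHat A P PC PK ξ k') ≤
      ‖cosetAvg (rows PC PK) (Fin.append ξ k) f (r + m) -
        cosetAvg (rows PC PK) (Fin.append ξ k) f r‖ +
      ‖cosetAvg (rows PC PK) (Fin.append ξ k') f (r + m) -
        cosetAvg (rows PC PK) (Fin.append ξ k) f r‖ := by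
    rw [htr, Matrix.mul_sub, Matrix.trace_sub, hhat, hhat]
    refine (Complex.re_le_norm _).trans ?_
    rw [← sub_sub_sub_cancel_right _ _ (cosetAvg (rows PC PK) (Fin.append ξ k) f r)]
    exact norm_sub_le _ _
  -- Each key costs `m * (2 * √P)`; there are two keys, and the factor `1 / 2` leaves `2 * m * √P`.
  linarith
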